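/- Let $l \ge 1$ be an integer and let $G$ be a finite simple graph of order $n \ge l+3$ with vertex connectivity $\kappa(G) \ge l+1$, where $\kappa(G)$ is the least number of vertices whose deletion leaves a graph that is disconnected or has at most one vertex (so $\kappa(K_n)=n-1$). Let $$\sigma_3(G)=\min\Big\{\sum_{x\in X} d_G(x) : X\subseteq V(G) \text{ independent},\ |X|=3\Big\},$$ with $\sigma_3(G)=+\infty$ if $G$ has no independent set of three vertices. If $\sigma_3(G)\ge n+2l$, then $G$ is $(P_{\ge 3},l)$-factor critical; that is, for every $V'\subseteq V(G)$ with $|V'|=l$, the graph $G-V'$ has a $P_{\ge 3}$-factor, i.e. a spanning subgraph each of whose connected components is a path with at least three vertices. -/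

import Mathlib

namespace PathFactor

/-- The vertex connectivity `κ(G)` of a finite graph: the least number of vertices whose deletion
leaves a graph that is disconnected or has at most one vertex (so `κ(K_n) = n - 1`). -/
noncomputable def vertexConnectivity {V : Type*} [Fintype V] (G : SimpleGraph V) : ℕ :=
  sInf {k : ℕ | ∃ S : Finset V, S.card = k ∧
    (¬ (G.induce {v | v ∉ S}).Preconnected ∨ Fintype.card V ≤ S.card + 1)}

/-- The degree sum `σ_k(G)`: the minimum of `∑ x ∈ X, d_G(x)` over all independent sets `X` of
exactly `k` vertices; it is `⊤` (that is, `+∞`) if there is no such set. -/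
noncomputable def degreeSum {V : Type*} [Fintype V] (G : SimpleGraph V) [DecidableRel G.Adj]
    (k : ℕ) : ℕ∞ :=
  ⨅ (X : Finset V) (_ : G.IsNIndepSet k X), ((∑ x ∈ X, G.degree x : ℕ) : ℕ∞)

/-- `H` is a `P_{≥ k}`-factor of `G`: a spanning subgraph each of whose connected components is
isomorphic to a path of order at least `k`. -/
def IsPathFactor {V : Type*} (G : SimpleGraph V) (k : ℕ) (H : SimpleGraph V) : Prop :=
  H ≤ G ∧ ∀ c : H.ConnectedComponent,
    ∃ m : ℕ, k ≤ m ∧ Nonempty (c.toSimpleGraph ≃g SimpleGraph.pathGraph m)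

/-- `G` is `(P_{≥ k}, l)`-factor critical: for every set `S` of exactly `l` vertices, the graph
`G - S` has a `P_{≥ k}`-factor. -/
def IsPathFactorCritical {V : Type*} (G : SimpleGraph V) (k l : ℕ) : Prop :=
  ∀ S : Finset V, S.card = l →
    ∃ H : SimpleGraph {v | v ∉ S}, IsPathFactor (G.induce {v | v ∉ S}) k H

end PathFactor

/-! ### Path systems and the exchange principle. -/

namespace PathFactor
variable {V : Type*}

/-! Deleting the `l` vertices leaves a connected graph of order `n - l`. Each degree drops by at
most `l`, so independent triples there still have degree sum at least `n + 2l - 3l = n - l`. It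
remains to see that a connected graph with `σ₃ ≥ |V| ≥ 3` has a spanning path system. Take one
covering the most vertices and cut its paths to orders 3, 4, 5. If it is not spanning, connectedness
gives an edge from an uncovered `v` to a path. Exchanges with `v` leave only inner vertices of the
path as neighbours: the centre (orders 3, 5) or one middle vertex (order 4). Then `v` and the two
ends of that path are independent, and together they send at most `|q|` edges to each path `q`. The
ends have no uncovered neighbour and `v` is not its own, so the three degrees sum to less than `|V|`
(`false_of_triple`). -/

/-- A family of vertex-disjoint paths of `G` (as lists of vertices), each of order at least 3. -/
def IsPathSystem (G : SimpleGraph V) (L : List (List V)) : Prop :=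
  (∀ p ∈ L, p.IsChain G.Adj ∧ 3 ≤ p.length) ∧ L.flatten.Nodup

/-- A path system covering the largest possible number of vertices. -/
def IsMaxPathSystem (G : SimpleGraph V) (L : List (List V)) : Prop :=
  IsPathSystem G L ∧ ∀ L', IsPathSystem G L' → L'.flatten.length ≤ L.flatten.length

variable {G : SimpleGraph V}

lemma IsMaxPathSystem.perm {L L' : List (List V)} (hL : IsMaxPathSystem G L) (h : L.Perm L') :
    IsMaxPathSystem G L' := by
  refine ⟨⟨fun p hp => hL.1.1 p (h.mem_iff.2 hp), h.flatten.nodup_iff.1 hL.1.2⟩, fun L'' h'' => ?_⟩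
  rw [← h.flatten.length_eq]
  exact hL.2 L'' h''

lemma exists_of_length {p : List V} (h3 : 3 ≤ p.length) (h5 : p.length ≤ 5) :
    (∃ a b c, p = [a, b, c]) ∨ (∃ a b c d, p = [a, b, c, d]) ∨
      ∃ a b c d e, p = [a, b, c, d, e] := by
  match p with
  | [a, b, c] => simp
  | [a, b, c, d] => simp
  | [a, b, c, d, e] => simp
  | [] | [_] | [_, _] => simp at h3
  | _ :: _ :: _ :: _ :: _ :: _ :: _ => simp at h5; omega

open Classical in
/-- The number of entries of the list `p` adjacent to `x`. -/
noncomputable def adjCount (G : SimpleGraph V) (x : V) (p : List V) : ℕ :=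
  p.countP (fun y => decide (G.Adj x y))

lemma adjCount_nil (x : V) : adjCount G x [] = 0 := rfl

lemma adjCount_cons_of_not_adj {x y : V} (h : ¬ G.Adj x y) (p : List V) :
    adjCount G x (y :: p) = adjCount G x p := by
  simp [adjCount, h]

lemma adjCount_cons_le (x y : V) (p : List V) : adjCount G x (y :: p) ≤ adjCount G x p + 1 := by
  simp only [adjCount, List.countP_cons]
  split <;> omega

lemma adjCount_flatten (x : V) (L : List (List V)) :
    adjCount G x L.flatten = (L.map (adjCount G x)).sum := by
  induction L with
  | nil => rfl
  | cons p L ih =>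
    rw [List.flatten_cons, List.map_cons, List.sum_cons, ← ih]
    simp [adjCount, List.countP_append]

/-- Replacing the subfamily `A` and the uncovered vertices `W` by paths `B` and leftover `C`. -/
lemma IsMaxPathSystem.exchange {R : List (List V)} (A B : List (List V)) (W C : List V)
    (hL : IsMaxPathSystem G (A ++ R)) (hW : W.Nodup) (hd : ∀ w ∈ W, w ∉ (A ++ R).flatten)
    (hB : ∀ p ∈ B, p.IsChain G.Adj ∧ 3 ≤ p.length)
    (hp : (B.flatten ++ C).Perm (A.flatten ++ W) := by
      rw [List.perm_iff_count]; intro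
      simp only [List.flatten_cons, List.flatten_nil, List.append_assoc, List.count_append,
        List.count_cons, List.count_nil]
      ring) :
    B.flatten.length ≤ A.flatten.length ∧
      (B.flatten.length = A.flatten.length →
        IsMaxPathSystem G (B ++ R) ∧ ∀ w ∈ C, w ∉ (B ++ R).flatten) := by
  have h1 : ((A.flatten ++ W) ++ R.flatten).Nodup := by
    have h2 : ((A ++ R).flatten ++ W).Nodup :=
      List.Nodup.append hL.1.2 hW (fun a ha hw => hd a hw ha)
    refine (List.Perm.nodup_iff ?_).1 h2
    simp only [List.flatten_append, List.append_assoc]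
    exact List.Perm.append_left _ List.perm_append_comm
  have h3 : ((B.flatten ++ C) ++ R.flatten).Nodup :=
    (List.Perm.nodup_iff (hp.append_right _)).2 h1
  have h4 : ((B ++ R).flatten ++ C).Nodup := by
    refine (List.Perm.nodup_iff ?_).1 h3
    simp only [List.flatten_append, List.append_assoc]
    exact List.Perm.append_left _ List.perm_append_comm
  have hS : IsPathSystem G (B ++ R) := by
    refine ⟨fun p hp => ?_, (List.nodup_append.1 h4).1⟩
    rcases List.mem_append.1 hp with h | h
    · exact hB p h
    · exact hL.1.1 p (List.mem_append_right _ h)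
  have hle := hL.2 _ hS
  simp only [List.flatten_append, List.length_append] at hle
  refine ⟨by omega, fun he => ⟨⟨hS, fun L' hL' => ?_⟩, fun w hw hm => ?_⟩⟩
  · have := hL.2 _ hL'
    simp only [List.flatten_append, List.length_append] at this ⊢
    omega
  · exact (List.nodup_append.1 h4).2.2 w hm w hw rfl


lemma IsMaxPathSystem.no_gain {R : List (List V)} (A B : List (List V)) (W C : List V)
    (hL : IsMaxPathSystem G (A ++ R)) (hd : ∀ w ∈ W, w ∉ (A ++ R).flatten)
    (hB : ∀ p ∈ B, p.IsChain G.Adj ∧ 3 ≤ p.length)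
    (hp : (B.flatten ++ C).Perm (A.flatten ++ W) := by
      rw [List.perm_iff_count]; intro
      simp only [List.flatten_cons, List.flatten_nil, List.append_assoc, List.count_append,
        List.count_cons, List.count_nil]
      ring)
    (hW : W.Nodup := by simp)
    (hlt : A.flatten.length < B.flatten.length := by simp) : False :=
  absurd (hL.exchange A B W C hW hd hB hp).1 (by omega)

lemma IsMaxPathSystem.reverse_head {p : List V} {R : List (List V)}
    (hL : IsMaxPathSystem G (p :: R)) : IsMaxPathSystem G (p.reverse :: R) := by
  have h := IsMaxPathSystem.exchange (R := R) [p] [p.reverse] [] [] hL (by simp) (by simp)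
    (by
      have := hL.1.1 p (by simp)
      simp only [List.mem_singleton, forall_eq, List.length_reverse]
      exact ⟨List.isChain_reverse.2 (by simpa [flip, G.adj_comm] using this.1), this.2⟩)
    (by simp)
  exact (h.2 (by simp)).1

/-! ### Neighbours of an uncovered vertex on one short path. -/

section Single
variable [DecidableEq V] {R : List (List V)} {a b c d e v : V}

lemma not_adj_three (hL : IsMaxPathSystem G ([a, b, c] :: R))
    (hv : v ∉ ([a, b, c] :: R).flatten) : ¬ G.Adj v a ∧ ¬ G.Adj v c := by
  have hc := hL.1.1 _ List.mem_cons_self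
  refine ⟨fun h => ?_, fun h => ?_⟩
  · exact IsMaxPathSystem.no_gain [[a, b, c]] [[v, a, b, c]] [v] [] hL (by simpa using hv)
      (by grind [G.adj_comm])
  · exact IsMaxPathSystem.no_gain [[a, b, c]] [[v, c, b, a]] [v] [] hL (by simpa using hv)
      (by grind [G.adj_comm])

/-- Adjacent to both middle vertices, `v` could be inserted between them. -/
lemma not_adj_four (hL : IsMaxPathSystem G ([a, b, c, d] :: R))
    (hv : v ∉ ([a, b, c, d] :: R).flatten) :
    ¬ G.Adj v a ∧ ¬ G.Adj v d ∧ ¬ (G.Adj v b ∧ G.Adj v c) := by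
  have hc := hL.1.1 _ List.mem_cons_self
  refine ⟨fun h => ?_, fun h => ?_, fun h => ?_⟩
  · exact IsMaxPathSystem.no_gain [[a, b, c, d]] [[v, a, b, c, d]] [v] [] hL (by simpa using hv)
      (by grind [G.adj_comm])
  · exact IsMaxPathSystem.no_gain [[a, b, c, d]] [[v, d, c, b, a]] [v] [] hL (by simpa using hv)
      (by grind [G.adj_comm])
  · exact IsMaxPathSystem.no_gain [[a, b, c, d]] [[a, b, v, c, d]] [v] [] hL (by simpa using hv)
      (by grind [G.adj_comm])

/-- A neighbour at `b` or `d` lets the six vertices split into two paths of order 3; only the centre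
survives. -/
lemma not_adj_five (hL : IsMaxPathSystem G ([a, b, c, d, e] :: R))
    (hv : v ∉ ([a, b, c, d, e] :: R).flatten) :
    ¬ G.Adj v a ∧ ¬ G.Adj v b ∧ ¬ G.Adj v d ∧ ¬ G.Adj v e := by
  have hc := hL.1.1 _ List.mem_cons_self
  refine ⟨fun h => ?_, fun h => ?_, fun h => ?_, fun h => ?_⟩
  · exact IsMaxPathSystem.no_gain [[a, b, c, d, e]] [[v, a, b, c, d, e]] [v] [] hL
      (by simpa using hv) (by grind [G.adj_comm])
  · exact IsMaxPathSystem.no_gain [[a, b, c, d, e]] [[v, b, a], [c, d, e]] [v] [] hL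
      (by simpa using hv) (by grind [G.adj_comm])
  · exact IsMaxPathSystem.no_gain [[a, b, c, d, e]] [[v, d, e], [c, b, a]] [v] [] hL
      (by simpa using hv) (by grind [G.adj_comm])
  · exact IsMaxPathSystem.no_gain [[a, b, c, d, e]] [[v, e, d, c, b, a]] [v] [] hL
      (by simpa using hv) (by grind [G.adj_comm])

end Single

lemma adjCount_le_one [DecidableEq V] {L : List (List V)} {q : List V} {v : V} (hL : IsMaxPathSystem G L)
    (hq : q ∈ L) (h5 : q.length ≤ 5) (hv : v ∉ L.flatten) : adjCount G v q ≤ 1 := by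
  have hp := List.perm_cons_erase hq
  have hL' := hL.perm hp
  have hv' := fun h => hv (hp.flatten.mem_iff.2 h)
  have n0 := adjCount_nil (G := G) v
  have n1 := adjCount_cons_le (G := G) v
  have n2 := @adjCount_cons_of_not_adj V G v
  obtain ⟨a, b, c, rfl⟩ | ⟨a, b, c, d, rfl⟩ | ⟨a, b, c, d, e, rfl⟩ :=
    exists_of_length (hL.1.1 q hq).2 h5
  · have := not_adj_three hL' hv'
    grind
  · have := not_adj_four hL' hv'
    grind
  · have := not_adj_five hL' hv'
    grind
end PathFactor

/-! ### Exchanges across two paths, and the degree count. -/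

namespace PathFactor
variable {V : Type*} [DecidableEq V] {G : SimpleGraph V}

/-- If `p` together with an uncovered vertex `v` can be rearranged into a path `p₀` and an edge
`xy`, then `x`, `y` and the vertices of another path `q` cannot be covered by paths. -/
lemma IsMaxPathSystem.no_gain_pair {p p₀ q : List V} {R : List (List V)} {v x y : V}
    (hL : IsMaxPathSystem G (p :: q :: R)) (hv : v ∉ (p :: q :: R).flatten)
    (hp₀ : p₀.IsChain G.Adj ∧ 3 ≤ p₀.length) (hp : (p₀ ++ [x, y]).Perm (p ++ [v]))
    (B : List (List V)) (hB : ∀ p ∈ B, p.IsChain G.Adj ∧ 3 ≤ p.length)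
    (hBp : B.flatten.Perm ([x, y] ++ q) := by
      rw [List.perm_iff_count]; intro
      simp only [List.flatten_cons, List.flatten_nil, List.append_assoc, List.count_append,
        List.count_cons, List.count_nil]
      ring) : False := by
  have hlen := hp.length_eq
  refine IsMaxPathSystem.no_gain (R := R) [p, q] (p₀ :: B) [v] [] hL (by simpa using hv) ?_ ?_
    (by simp) ?_
  · intro p' hp'
    rcases List.mem_cons.1 hp' with rfl | h
    · exact hp₀
    · exact hB _ h
  · have h1 : (p₀ ++ B.flatten).Perm (p₀ ++ ([x, y] ++ q)) := hBp.append_left _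
    have h2 := hp.append_right q
    rw [List.perm_iff_count] at h1 h2 ⊢
    intro a
    have := h1 a
    have := h2 a
    simp only [List.flatten_cons, List.flatten_nil, List.count_append, List.count_nil] at *
    omega
  · have := hBp.length_eq
    simp only [List.flatten_cons, List.flatten_nil, List.length_append, List.length_cons,
      List.length_nil] at *
    omega

/-- If `p` together with an uncovered vertex `v` can be rearranged into a path `p₀` and an edge
`xy`, then the adjacencies of `y` to the other paths are restricted. -/
lemma adjCount_pair_le {p p₀ q : List V} {R : List (List V)} {v x y : V}
    (hL : IsMaxPathSystem G (p :: q :: R)) (hv : v ∉ (p :: q :: R).flatten) (h5 : q.length ≤ 5)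
    (hp₀ : p₀.IsChain G.Adj ∧ 3 ≤ p₀.length) (hxy : G.Adj x y)
    (hp : (p₀ ++ [x, y]).Perm (p ++ [v])) :
    adjCount G y q ≤ 1 ∨
      ∃ a b c d, q = [a, b, c, d] ∧ G.Adj y b ∧ G.Adj y c ∧ adjCount G y q ≤ 2 := by
  have hc := hL.1.1 q (by simp)
  have n0 := adjCount_nil (G := G) y
  have n1 := adjCount_cons_le (G := G) y
  have n2 := @adjCount_cons_of_not_adj V G y
  obtain ⟨a, b, c, rfl⟩ | ⟨a, b, c, d, rfl⟩ | ⟨a, b, c, d, e, rfl⟩ :=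
    exists_of_length hc.2 h5
  · have ha : ¬ G.Adj y a := fun h => hL.no_gain_pair hv hp₀ hp [[x, y, a, b, c]] (by grind)
    have hb : ¬ G.Adj y c := fun h => hL.no_gain_pair hv hp₀ hp [[x, y, c, b, a]] (by grind [G.adj_comm])
    grind
  · have ha : ¬ G.Adj y a := fun h => hL.no_gain_pair hv hp₀ hp [[x, y, a, b, c, d]] (by grind)
    have hd : ¬ G.Adj y d := fun h => hL.no_gain_pair hv hp₀ hp [[x, y, d, c, b, a]] (by grind [G.adj_comm])
    -- Inserting `y` between `b` and `c` strands `x`, so nothing is gained and this case cannot be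
    -- excluded here.
    by_cases hbc : G.Adj y b ∧ G.Adj y c
    · exact Or.inr ⟨a, b, c, d, rfl, hbc.1, hbc.2, by grind⟩
    · left
      grind
  · have ha : ¬ G.Adj y a := fun h => hL.no_gain_pair hv hp₀ hp [[x, y, a, b, c, d, e]] (by grind)
    have hb : ¬ G.Adj y b := fun h => hL.no_gain_pair hv hp₀ hp [[x, y, b, a], [c, d, e]] (by grind [G.adj_comm])
    have hd : ¬ G.Adj y d := fun h => hL.no_gain_pair hv hp₀ hp [[x, y, d, e], [c, b, a]] (by grind [G.adj_comm])
    have he : ¬ G.Adj y e := fun h => hL.no_gain_pair hv hp₀ hp [[x, y, e, d, c, b, a]] (by grind [G.adj_comm])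
    grind

/-- The hypothesis `σ₃(G) ≥ |V|` in elementary form. -/
def DegreeSumThreeGe [Fintype V] (G : SimpleGraph V) [DecidableRel G.Adj] : Prop :=
  ∀ x y z, x ≠ y → x ≠ z → y ≠ z → ¬ G.Adj x y → ¬ G.Adj x z → ¬ G.Adj y z →
    Fintype.card V ≤ G.degree x + G.degree y + G.degree z

variable [Fintype V] [DecidableRel G.Adj]

lemma degree_eq_adjCount {L : List V} (hL : L.Nodup) (hall : ∀ v, v ∈ L) (x : V) :
    G.degree x = adjCount G x L := by
  rw [adjCount, List.countP_eq_length_filter, ← G.card_neighborFinset_eq_degree,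
    ← List.toFinset_card_of_nodup (hL.filter _)]
  congr 1
  ext w
  simp [hall]

/-- Summing `hq` bounds the edges into covered vertices by their number. Among uncovered vertices
only `x` has neighbours, and it misses itself, so the total is below `|V|`. -/
lemma false_of_triple (hσ : DegreeSumThreeGe G) {L : List (List V)} (hL : L.flatten.Nodup)
    {x y z : V} (hx : x ∉ L.flatten) (hy : y ∈ L.flatten) (hz : z ∈ L.flatten) (hyz : y ≠ z)
    (hy' : ∀ w ∉ L.flatten, ¬ G.Adj w y) (hz' : ∀ w ∉ L.flatten, ¬ G.Adj w z)
    (hyz' : ¬ G.Adj y z)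
    (hq : ∀ q ∈ L, adjCount G x q + adjCount G y q + adjCount G z q ≤ q.length) : False := by
  set U : List V := (Finset.univ.filter (· ∉ L.flatten)).toList with hU
  have hmem : ∀ w, w ∈ U ↔ w ∉ L.flatten := fun w => by simp [hU]
  have hnd : (L.flatten ++ U).Nodup :=
    List.Nodup.append hL (Finset.nodup_toList _) (fun a ha hb => (hmem a).1 hb ha)
  have hall : ∀ w, w ∈ L.flatten ++ U := fun w => by
    rw [List.mem_append, hmem]; exact em _
  have hcard : Fintype.card V = L.flatten.length + U.length := by
    rw [← List.length_append, ← List.toFinset_card_of_nodup hnd, ← Finset.card_univ]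
    congr 1
    ext w
    simp only [Finset.mem_univ, List.mem_toFinset, true_iff]
    exact hall w
  have hdeg : ∀ w, G.degree w = (L.map (adjCount G w)).sum + adjCount G w U := fun w => by
    rw [degree_eq_adjCount hnd hall, ← adjCount_flatten]
    simp [adjCount, List.countP_append]
  have h0 : ∀ w, (∀ w' ∉ L.flatten, ¬ G.Adj w' w) → adjCount G w U = 0 := by
    intro w hw
    rw [adjCount, List.countP_eq_zero]
    intro w' hw'
    simpa [G.adj_comm] using hw w' ((hmem w').1 hw')
  have hxU : adjCount G x U < U.length := by
    rw [adjCount, List.countP_lt_length_iff]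
    exact ⟨x, (hmem x).2 hx, by simp⟩
  have hsum : (L.map (adjCount G x)).sum + (L.map (adjCount G y)).sum + (L.map (adjCount G z)).sum
      ≤ L.flatten.length := by
    clear * - hq
    induction L with
    | nil => simp
    | cons p L ih =>
      have h1 := hq p (by simp)
      have h2 := ih (fun q h => hq q (by simp [h]))
      simp only [List.map_cons, List.sum_cons, List.flatten_cons, List.length_append]
      omega
  have := hσ x y z (by grind) (by grind) hyz (hy' x hx) (hz' x hx) hyz'
  rw [hdeg x, hdeg y, hdeg z, h0 y hy', h0 z hz'] at this
  omega

/-! ### The surviving adjacencies, refuted by the degree count. -/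

section Cases
variable {R : List (List V)} {a b c d e v : V}

lemma not_adj_center_three (hσ : DegreeSumThreeGe G) (hL : IsMaxPathSystem G ([a, b, c] :: R))
    (hR : ∀ q ∈ R, q.length ≤ 5) (hv : v ∉ ([a, b, c] :: R).flatten) : ¬ G.Adj v b := by
  intro hvb
  have hc := hL.1.1 _ List.mem_cons_self
  have hnd := hL.1.2
  have hac : ¬ G.Adj a c := fun h =>
    IsMaxPathSystem.no_gain [[a, b, c]] [[v, b, a, c]] [v] [] hL (by simpa using hv)
      (by grind [G.adj_comm])
  -- Swapping `v` for `a` (then for `c`) keeps the system maximum with that end uncovered, so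
  -- `adjCount_le_one` applies to the end.
  obtain ⟨hLa, ha⟩ := (IsMaxPathSystem.exchange [[a, b, c]] [[v, b, c]] [v] [a] hL (by simp)
    (by simpa using hv) (by grind)).2 (by simp)
  obtain ⟨hLc, hc'⟩ := (IsMaxPathSystem.exchange [[a, b, c]] [[v, b, a]] [v] [c] hL (by simp)
    (by simpa using hv) (by grind [G.adj_comm])).2 (by simp)
  refine false_of_triple hσ hnd hv (y := a) (z := c) (by simp) (by simp)
    (fun h => by simp [h] at hnd)
    (fun w hw => (not_adj_three hL hw).1) (fun w hw => (not_adj_three hL hw).2) hac ?_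
  intro q hq
  rcases List.mem_cons.1 hq with rfl | hqR
  · have h1 := adjCount_le_one hL hq (by simp) hv
    have h2 : adjCount G a [a, b, c] ≤ 1 := by
      simp only [adjCount, List.countP_cons, List.countP_nil, hac, G.irrefl]
      grind
    have h3 : adjCount G c [a, b, c] ≤ 1 := by
      simp only [adjCount, List.countP_cons, List.countP_nil, mt G.adj_symm hac, G.irrefl]
      grind
    simp only [List.length_cons, List.length_nil]
    omega
  · have h1 := adjCount_le_one hL hq (hR q hqR) hv
    have h2 := adjCount_le_one hLa (by simp [hqR]) (hR q hqR) (ha a (by simp))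
    have h3 := adjCount_le_one hLc (by simp [hqR]) (hR q hqR) (hc' c (by simp))
    have := (hL.1.1 q hq).2
    omega

/-- The end `a` can be traded for `v`, but `d` cannot; it is controlled through the path `v, b, a`
and the edge `cd`. It may have two neighbours on a path of order 4, where `1 + 1 + 2` still fits. -/
lemma not_adj_second_four (hσ : DegreeSumThreeGe G) (hL : IsMaxPathSystem G ([a, b, c, d] :: R))
    (hR : ∀ q ∈ R, q.length ≤ 5) (hv : v ∉ ([a, b, c, d] :: R).flatten) : ¬ G.Adj v b := by
  intro hvb
  have hc := hL.1.1 _ List.mem_cons_self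
  have hnd := hL.1.2
  have had : ¬ G.Adj a d := fun h =>
    IsMaxPathSystem.no_gain [[a, b, c, d]] [[v, b, a, d, c]] [v] [] hL (by simpa using hv)
      (by grind [G.adj_comm])
  have hac : ¬ G.Adj a c := fun h =>
    IsMaxPathSystem.no_gain [[a, b, c, d]] [[v, b, a, c, d]] [v] [] hL (by simpa using hv)
      (by grind [G.adj_comm])
  obtain ⟨hLa, ha⟩ := (IsMaxPathSystem.exchange [[a, b, c, d]] [[v, b, c, d]] [v] [a] hL (by simp)
    (by simpa using hv) (by grind)).2 (by simp)
  refine false_of_triple hσ hnd hv (y := a) (z := d) (by simp) (by simp)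
    (fun h => by simp [h] at hnd)
    (fun w hw => (not_adj_four hL hw).1) (fun w hw => (not_adj_four hL hw).2.1) had ?_
  intro q hq
  rcases List.mem_cons.1 hq with rfl | hqR
  · have h1 := adjCount_le_one hL hq (by simp) hv
    have h2 : adjCount G a [a, b, c, d] ≤ 1 := by
      simp only [adjCount, List.countP_cons, List.countP_nil, hac, had, G.irrefl]
      grind
    have h3 : adjCount G d [a, b, c, d] ≤ 2 := by
      simp only [adjCount, List.countP_cons, List.countP_nil, mt G.adj_symm had, G.irrefl]
      grind
    simp only [List.length_cons, List.length_nil]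
    omega
  · have h1 := adjCount_le_one hL hq (hR q hqR) hv
    have h2 := adjCount_le_one hLa (by simp [hqR]) (hR q hqR) (ha a (by simp))
    have hp : ([a, b, c, d] :: R).Perm ([a, b, c, d] :: q :: R.erase q) :=
      (List.perm_cons_erase hqR).cons _
    have h3 := adjCount_pair_le (p₀ := [v, b, a]) (x := c) (y := d) (hL.perm hp)
      (fun h => hv (hp.flatten.mem_iff.2 h)) (hR q hqR) (by grind [G.adj_comm]) (by grind)
      (by grind)
    have h4 := (hL.1.1 q hq).2
    rcases h3 with h3 | ⟨_, _, _, _, rfl, -, -, h3⟩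
    · omega
    · simp only [List.length_cons, List.length_nil]
      omega

/-- If `a` had two neighbours on another path, they would be the middle of one of order 4. Moving
`a` between them leaves `b, c, d, e` with `v` adjacent to its second vertex, already impossible. -/
lemma adjCount_end_five_le (hσ : DegreeSumThreeGe G)
    (hL : IsMaxPathSystem G ([a, b, c, d, e] :: R)) (hR : ∀ q ∈ R, q.length ≤ 5)
    (hv : v ∉ ([a, b, c, d, e] :: R).flatten) (hvc : G.Adj v c) {q : List V} (hqR : q ∈ R) :
    adjCount G a q ≤ 1 := by
  have hc := hL.1.1 _ List.mem_cons_self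
  have hp : ([a, b, c, d, e] :: R).Perm ([a, b, c, d, e] :: q :: R.erase q) :=
    (List.perm_cons_erase hqR).cons _
  have hL' := hL.perm hp
  have hv' := fun h => hv (hp.flatten.mem_iff.2 h)
  have hcq := hL'.1.1 q (by simp)
  rcases adjCount_pair_le (p₀ := [v, c, d, e]) (x := b) (y := a) hL' hv' (hR q hqR)
    (by grind) (by grind [G.adj_comm]) (by grind) with h | ⟨f, g, h, i, rfl, hag, hah, -⟩
  · exact h
  exfalso
  obtain ⟨hL2, -⟩ := (IsMaxPathSystem.exchange (R := R.erase [f, g, h, i])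
    [[a, b, c, d, e], [f, g, h, i]] [[b, c, d, e], [f, g, a, h, i]] [] [] hL' (by simp)
    (by simp) (by grind [G.adj_comm])).2 (by simp)
  refine not_adj_second_four hσ hL2 ?_ (v := v) ?_ hvc
  · intro q' hq'
    rcases List.mem_cons.1 hq' with rfl | h'
    · simp
    · exact hR q' (List.mem_of_mem_erase h')
  · simp at hv' ⊢
    grind

lemma not_adj_center_five (hσ : DegreeSumThreeGe G)
    (hL : IsMaxPathSystem G ([a, b, c, d, e] :: R)) (hR : ∀ q ∈ R, q.length ≤ 5)
    (hv : v ∉ ([a, b, c, d, e] :: R).flatten) : ¬ G.Adj v c := by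
  intro hvc
  have hc := hL.1.1 _ List.mem_cons_self
  have hnd := hL.1.2
  have hae : ¬ G.Adj a e := fun h =>
    IsMaxPathSystem.no_gain [[a, b, c, d, e]] [[v, c, b, a, e, d]] [v] [] hL (by simpa using hv)
      (by grind [G.adj_comm])
  have had : ¬ G.Adj a d := fun h =>
    IsMaxPathSystem.no_gain [[a, b, c, d, e]] [[v, c, b, a, d, e]] [v] [] hL (by simpa using hv)
      (by grind [G.adj_comm])
  have heb : ¬ G.Adj e b := fun h =>
    IsMaxPathSystem.no_gain [[a, b, c, d, e]] [[v, c, d, e, b, a]] [v] [] hL (by simpa using hv)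
      (by grind [G.adj_comm])
  refine false_of_triple hσ hnd hv (y := a) (z := e) (by simp) (by simp)
    (fun h => by simp [h] at hnd)
    (fun w hw => (not_adj_five hL hw).1) (fun w hw => (not_adj_five hL hw).2.2.2) hae ?_
  intro q hq
  rcases List.mem_cons.1 hq with rfl | hqR
  · have h1 := adjCount_le_one hL hq (by simp) hv
    have h2 : adjCount G a [a, b, c, d, e] ≤ 2 := by
      simp only [adjCount, List.countP_cons, List.countP_nil, had, hae, G.irrefl]
      grind
    have h3 : adjCount G e [a, b, c, d, e] ≤ 2 := by
      simp only [adjCount, List.countP_cons, List.countP_nil, heb, mt G.adj_symm hae, G.irrefl]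
      grind
    simp only [List.length_cons, List.length_nil]
    omega
  · have h1 := adjCount_le_one hL hq (hR q hqR) hv
    have h2 := adjCount_end_five_le hσ hL hR hv hvc hqR
    -- Reversing the path makes `e` its first vertex and keeps `c` central.
    have h3 := adjCount_end_five_le hσ hL.reverse_head hR (v := v) (by simp at hv ⊢; grind) hvc hqR
    have := (hL.1.1 q hq).2
    omega

end Cases

lemma not_adj_of_uncovered (hσ : DegreeSumThreeGe G) {L : List (List V)} (hL : IsMaxPathSystem G L)
    (h5 : ∀ q ∈ L, q.length ≤ 5) {v w : V} (hv : v ∉ L.flatten) (hw : w ∈ L.flatten) :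
    ¬ G.Adj v w := by
  obtain ⟨q, hq, hwq⟩ := List.mem_flatten.1 hw
  have hp := List.perm_cons_erase hq
  have hL' := hL.perm hp
  have hv' := fun h => hv (hp.flatten.mem_iff.2 h)
  have hR : ∀ q' ∈ L.erase q, q'.length ≤ 5 := fun q' h => h5 q' (List.mem_of_mem_erase h)
  obtain ⟨a, b, c, rfl⟩ | ⟨a, b, c, d, rfl⟩ | ⟨a, b, c, d, e, rfl⟩ :=
    exists_of_length (hL.1.1 q hq).2 (h5 q hq)
  · have h1 := not_adj_three hL' hv'
    have h2 := not_adj_center_three hσ hL' hR hv'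
    grind
  · have h1 := not_adj_four hL' hv'
    have h2 := not_adj_second_four hσ hL' hR hv'
    have h3 := not_adj_second_four hσ hL'.reverse_head hR (v := v) (by simp at hv' ⊢; grind)
    grind
  · have h1 := not_adj_five hL' hv'
    have h2 := not_adj_center_five hσ hL' hR hv'
    grind

end PathFactor

/-! ### Existence of a short maximum system; the spanning theorem. -/

namespace PathFactor
variable {V : Type*} {G : SimpleGraph V}

/-- A path of order at least 6 can lose its first three vertices and still have at least three left.
-/
lemma exists_split_short (p : List V) (hc : p.IsChain G.Adj) (h3 : 3 ≤ p.length) :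
    ∃ B : List (List V), B.flatten = p ∧
      ∀ q ∈ B, (q.IsChain G.Adj ∧ 3 ≤ q.length) ∧ q.length ≤ 5 := by
  induction hn : p.length using Nat.strong_induction_on generalizing p with
  | _ n ih =>
    by_cases h5 : p.length ≤ 5
    · exact ⟨[p], by simp, by simp [hc, h3, h5]⟩
    · obtain ⟨B, hB, hB'⟩ := ih (p.drop 3).length (by simp; omega) (p.drop 3) (hc.drop 3)
        (by simp; omega) rfl
      refine ⟨p.take 3 :: B, by simp [hB], ?_⟩
      intro q hq
      rcases List.mem_cons.1 hq with rfl | h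
      · exact ⟨⟨hc.take 3, by simp; omega⟩, by simp⟩
      · exact hB' q h

lemma exists_short_isMaxPathSystem [Fintype V] (G : SimpleGraph V) :
    ∃ L, IsMaxPathSystem G L ∧ ∀ q ∈ L, q.length ≤ 5 := by
  have hbdd : ∀ n, (∃ L, IsPathSystem G L ∧ L.flatten.length = n) → n ≤ Fintype.card V := by
    rintro n ⟨L, hL, rfl⟩
    exact hL.2.length_le_card
  obtain ⟨n, ⟨L, hL, rfl⟩, hmax⟩ : ∃ n, (∃ L, IsPathSystem G L ∧ L.flatten.length = n) ∧
      ∀ m, (∃ L, IsPathSystem G L ∧ L.flatten.length = m) → m ≤ n := by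
    classical
    have h0 : ∃ L, IsPathSystem G L ∧ L.flatten.length = 0 := ⟨[], by simp [IsPathSystem], rfl⟩
    exact ⟨_, Nat.findGreatest_spec (P := fun n => ∃ L, IsPathSystem G L ∧ L.flatten.length = n)
      (Nat.zero_le (Fintype.card V)) h0, fun m hm => Nat.le_findGreatest (hbdd m hm) hm⟩
  have hsplit : ∀ L : List (List V), (∀ p ∈ L, p.IsChain G.Adj ∧ 3 ≤ p.length) →
      ∃ B : List (List V), B.flatten = L.flatten ∧
        ∀ q ∈ B, (q.IsChain G.Adj ∧ 3 ≤ q.length) ∧ q.length ≤ 5 := by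
    intro L
    induction L with
    | nil => exact fun _ => ⟨[], by simp⟩
    | cons p L ih =>
      intro h
      obtain ⟨B, hB, hB'⟩ := ih (fun q hq => h q (by simp [hq]))
      obtain ⟨C, hC, hC'⟩ := exists_split_short p (h p (by simp)).1 (h p (by simp)).2
      refine ⟨C ++ B, by simp [hB, hC], fun q hq => ?_⟩
      exact (List.mem_append.1 hq).elim (hC' q) (hB' q)
  obtain ⟨B, hB, hB'⟩ := hsplit L hL.1
  refine ⟨B, ⟨⟨fun q hq => (hB' q hq).1, hB ▸ hL.2⟩, fun L' hL' => ?_⟩, fun q hq => (hB' q hq).2⟩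
  rw [hB]
  exact hmax _ ⟨L', hL', rfl⟩

lemma exists_adj_boundary (hG : G.Preconnected) {S : Set V} {a b : V} (ha : a ∈ S) (hb : b ∉ S) :
    ∃ x y, x ∈ S ∧ y ∉ S ∧ G.Adj x y := by
  obtain ⟨w⟩ := hG a b
  obtain ⟨d, -, h1, h2⟩ := w.exists_boundary_dart S ha hb
  exact ⟨_, _, h1, h2, d.adj⟩

/-- A connected graph of order at least three contains a path on three vertices. -/
lemma exists_isPathSystem_singleton [Fintype V] (hG : G.Preconnected) (h3 : 3 ≤ Fintype.card V) :
    ∃ a b c, IsPathSystem G [[a, b, c]] := by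
  classical
  have : Nontrivial V := Fintype.one_lt_card_iff_nontrivial.1 (by omega)
  obtain ⟨a, b, hab⟩ := exists_pair_ne V
  obtain ⟨x, y, hx, hy, hxy⟩ := exists_adj_boundary hG (S := {a}) rfl hab.symm
  obtain ⟨z, hz⟩ : ∃ z, z ∉ ({x, y} : Finset V) := by
    by_contra! h
    have := Finset.card_le_card (fun v _ => h v : (Finset.univ : Finset V) ⊆ {x, y})
    have := Finset.card_le_two (a := x) (b := y)
    rw [Finset.card_univ] at *
    omega
  obtain ⟨s, t, hs, ht, hst⟩ := exists_adj_boundary hG (S := {x, y}) (a := x) (b := z) (by simp)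
    (by simpa using hz)
  have hne := hxy.ne
  simp only [Set.mem_insert_iff, Set.mem_singleton_iff, not_or] at hs ht
  rcases hs with rfl | rfl
  · refine ⟨y, s, t, ?_⟩
    simp [IsPathSystem, hxy.symm, hst, hst.ne, hne.symm, Ne.symm ht.2]
  · refine ⟨x, s, t, ?_⟩
    simp [IsPathSystem, hxy, hst, hst.ne, hne, Ne.symm ht.1]

/-- A connected graph with `σ₃(G) ≥ |V| ≥ 3` has a spanning path system. -/
theorem exists_spanning_isPathSystem [Fintype V] [DecidableRel G.Adj] (hG : G.Preconnected)
    (h3 : 3 ≤ Fintype.card V) (hσ : DegreeSumThreeGe G) :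
    ∃ L, IsPathSystem G L ∧ ∀ v, v ∈ L.flatten := by
  classical
  obtain ⟨L, hL, h5⟩ := exists_short_isMaxPathSystem G
  refine ⟨L, hL.1, fun v => ?_⟩
  by_contra hv
  obtain ⟨w, hw⟩ : ∃ w, w ∈ L.flatten := by
    obtain ⟨a, b, c, h⟩ := exists_isPathSystem_singleton hG h3
    have := hL.2 _ h
    exact List.exists_mem_of_length_pos (lt_of_lt_of_le (by simp) this)
  obtain ⟨x, y, hx, hy, hxy⟩ := exists_adj_boundary hG (S := {x | x ∉ L.flatten}) hv
    (by simpa using hw)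
  exact not_adj_of_uncovered hσ hL h5 hx (by simpa using hy) hxy

/-! ### From lists of vertices to a path factor. -/

/-- The graph whose edges join consecutive entries of the lists of `L`. -/
def systemGraph (L : List (List V)) (hL : L.flatten.Nodup) : SimpleGraph V where
  Adj a b := ∃ p ∈ L, ∃ (i j : ℕ) (hi : i < p.length) (hj : j < p.length),
    p[i] = a ∧ p[j] = b ∧ (i + 1 = j ∨ j + 1 = i)
  symm := ⟨fun a b ⟨p, hp, i, j, hi, hj, ha, hb, h⟩ => ⟨p, hp, j, i, hj, hi, hb, ha, h.symm⟩⟩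
  loopless := ⟨fun a ⟨p, hp, i, j, hi, hj, ha, hb, h⟩ => by
    have := (List.nodup_flatten.1 hL).1 p hp
    have := (this.getElem_inj_iff (hi := hi) (hj := hj)).1 (ha.trans hb.symm)
    omega⟩

lemma eq_of_mem_of_nodup_flatten {L : List (List V)} (hL : L.flatten.Nodup) {p q : List V}
    (hp : p ∈ L) (hq : q ∈ L) {a : V} (hap : a ∈ p) (haq : a ∈ q) : p = q := by
  by_contra hne
  have : Std.Symm (List.Disjoint (α := V)) := ⟨fun _ _ h => h.symm⟩
  exact (List.nodup_flatten.1 hL).2.forall hp hq hne hap haq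

lemma isPathFactor_systemGraph {L : List (List V)} (hL : IsPathSystem G L)
    (hall : ∀ v, v ∈ L.flatten) : IsPathFactor G 3 (systemGraph L hL.2) := by
  constructor
  · rintro a b ⟨p, hp, i, j, hi, hj, rfl, rfl, rfl | rfl⟩
    · exact List.isChain_iff_getElem.1 (hL.1 p hp).1 i hj
    · exact (List.isChain_iff_getElem.1 (hL.1 p hp).1 j hi).symm
  intro c
  induction c using SimpleGraph.ConnectedComponent.ind with | _ v
  obtain ⟨p, hp, hvp⟩ := List.mem_flatten.1 (hall v)
  have hnd := (List.nodup_flatten.1 hL.2).1 p hp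
  set H := systemGraph L hL.2 with hH
  have hzero : ∀ (i : ℕ) (hi : i < p.length) (h0 : 0 < p.length), H.Reachable p[i] p[0] := by
    intro i
    induction i with
    | zero => exact fun _ _ => SimpleGraph.Reachable.refl _
    | succ i ih =>
      intro hi h0
      refine SimpleGraph.Reachable.trans (SimpleGraph.Adj.reachable ?_) (ih (by omega) h0)
      exact ⟨p, hp, i + 1, i, hi, by omega, rfl, rfl, Or.inr rfl⟩
  have hreach : ∀ {a b}, a ∈ p → b ∈ p → H.Reachable a b := by
    intro a b ha hb
    obtain ⟨i, hi, rfl⟩ := List.getElem_of_mem ha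
    obtain ⟨j, hj, rfl⟩ := List.getElem_of_mem hb
    exact (hzero i hi (by omega)).trans (hzero j hj (by omega)).symm
  have hsupp : ∀ w, w ∈ (H.connectedComponentMk v).supp ↔ w ∈ p := by
    intro w
    rw [SimpleGraph.ConnectedComponent.mem_supp_iff, SimpleGraph.ConnectedComponent.eq]
    refine ⟨fun h => ?_, fun h => hreach h hvp⟩
    by_contra hw
    obtain ⟨W⟩ := h.symm
    -- A walk leaving `p` would use an edge with one end off `p`, but each edge lies in a single
    -- list and the lists are disjoint.
    obtain ⟨d, -, h1, h2⟩ := W.exists_boundary_dart {x | x ∈ p} hvp hw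
    obtain ⟨q, hq, i, j, hi, hj, ha, hb, -⟩ := d.adj
    have : p = q := eq_of_mem_of_nodup_flatten hL.2 hp hq h1 (ha ▸ List.getElem_mem hi)
    subst this
    exact h2 (hb ▸ List.getElem_mem hj)
  refine ⟨p.length, (hL.1 p hp).2, ⟨SimpleGraph.Iso.symm ⟨Equiv.ofBijective
    (fun i : Fin p.length => (⟨p[i], (hsupp _).2 (List.getElem_mem i.2)⟩ :
      (H.connectedComponentMk v).supp)) ⟨?_, ?_⟩, ?_⟩⟩⟩
  · intro i j hij
    exact Fin.ext ((hnd.getElem_inj_iff (hi := i.2) (hj := j.2)).1 (congrArg Subtype.val hij))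
  · rintro ⟨w, hw⟩
    obtain ⟨i, hi, rfl⟩ := List.getElem_of_mem ((hsupp w).1 hw)
    exact ⟨⟨i, hi⟩, rfl⟩
  · intro i j
    rw [SimpleGraph.pathGraph_adj]
    change H.Adj p[i] p[j] ↔ _
    constructor
    · rintro ⟨q, hq, i', j', hi, hj, ha, hb, h⟩
      have : p = q := eq_of_mem_of_nodup_flatten hL.2 hp hq (a := p[i]) (List.getElem_mem i.2)
        (ha ▸ List.getElem_mem hi)
      subst this
      have h1 := (hnd.getElem_inj_iff (hi := hi) (hj := i.2)).1 ha
      have h2 := (hnd.getElem_inj_iff (hi := hj) (hj := j.2)).1 hb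
      omega
    · intro h
      exact ⟨p, hp, i, j, i.2, j.2, rfl, rfl, h⟩

end PathFactor

/-! ### Reduction to the graph left after deleting `S`. -/

theorem theorem3 {V : Type*} [Fintype V] (G : SimpleGraph V) [DecidableRel G.Adj] (l : ℕ)
    (hl : 1 ≤ l) (hn : l + 3 ≤ Fintype.card V)
    (hconn : l + 1 ≤ PathFactor.vertexConnectivity G)
    (hdeg : ((Fintype.card V + 2 * l : ℕ) : ℕ∞) ≤ PathFactor.degreeSum G 3) :
    PathFactor.IsPathFactorCritical G 3 l := by
  classical
  intro S hS
  have hcard : Fintype.card {v | v ∉ S} = Fintype.card V - l := by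
    rw [← hS, ← Fintype.card_coe S]
    exact Fintype.card_subtype_compl (· ∈ S)
  have hpre : (G.induce {v | v ∉ S}).Preconnected := by
    by_contra h
    have : PathFactor.vertexConnectivity G ≤ l := Nat.sInf_le ⟨S, hS, Or.inl h⟩
    omega
  have hd : ∀ x : {v | v ∉ S}, G.degree x ≤ (G.induce {v | v ∉ S}).degree x + l := by
    intro x
    have hsub : G.neighborFinset x ⊆
        ((G.induce {v | v ∉ S}).neighborFinset x).map (Function.Embedding.subtype _) ∪ S := by
      intro w hw
      by_cases hwS : w ∈ S
      · exact Finset.mem_union_right _ hwS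
      · refine Finset.mem_union_left _ (Finset.mem_map.2 ⟨⟨w, hwS⟩, ?_, rfl⟩)
        simpa using hw
    have h := (Finset.card_le_card hsub).trans (Finset.card_union_le _ _)
    rwa [Finset.card_map, SimpleGraph.card_neighborFinset_eq_degree,
      SimpleGraph.card_neighborFinset_eq_degree, hS] at h
  have hσ : PathFactor.DegreeSumThreeGe (G.induce {v | v ∉ S}) := by
    intro x y z hxy hxz hyz axy axz ayz
    have hxy' : (x : V) ≠ y := fun h => hxy (Subtype.ext h)
    have hxz' : (x : V) ≠ z := fun h => hxz (Subtype.ext h)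
    have hyz' : (y : V) ≠ z := fun h => hyz (Subtype.ext h)
    have hI : G.IsNIndepSet 3 {(x : V), (y : V), (z : V)} := by
      simp only [SimpleGraph.comap_adj, Function.Embedding.subtype_apply] at axy axz ayz
      refine ⟨?_, Finset.card_eq_three.2 ⟨x, y, z, hxy', hxz', hyz', rfl⟩⟩
      intro a ha b hb _
      simp only [Finset.coe_insert, Finset.coe_singleton, Set.mem_insert_iff,
        Set.mem_singleton_iff] at ha hb
      rcases ha with rfl | rfl | rfl <;> rcases hb with rfl | rfl | rfl <;>
        simp_all [G.adj_comm]
    have h := hdeg.trans (iInf₂_le _ hI)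
    rw [Finset.sum_insert (by simp [hxy', hxz']), Finset.sum_pair hyz'] at h
    have h' : Fintype.card V + 2 * l ≤ G.degree x + (G.degree y + G.degree z) := by
      exact_mod_cast h
    have := hd x
    have := hd y
    have := hd z
    -- Three losses of at most `l` turn `n + 2l` into `n - l`, the order of the remaining graph.
    omega
  obtain ⟨L, hL, hall⟩ := PathFactor.exists_spanning_isPathSystem hpre (by omega) hσ
  exact ⟨_, PathFactor.isPathFactor_systemGraph hL hall⟩
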